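/- A 3-graph is a hypergraph in which every edge consists of exactly three vertices; it is linear if any two distinct edges share at most one vertex. A hypergraph is 2-regular if it has at least one edge and each of its vertices lies in exactly two edges. A subhypergraph of $H$ is a hypergraph whose vertex set and edge set are contained in those of $H$. For integers $n\ge 0$ and $t\geq 1$, let $f(n;t)$ be the maximum number of edges in an $n$-vertex linear 3-graph which contains no 2-regular subhypergraph with at most $t$ edges. **Theorem.** For every integer $\ell\ge 2$ there is a constant $c=c(\ell)$ such that, for every $n$, every $n$-vertex linear 3-graph with more than $c\,n^{3/2+1/\ell}$ edges contains a 2-regular subhypergraph with exactly $4\ell$ edges; in particular, $$f(n;4\ell)\le c\,n^{3/2+1/\ell}.$$ Consequently, there is an absolute constant $C$ such that for every integer $t\ge 1$ there is a constant $c'=c'(t)$ with $f(n;t)\le c'\,n^{3/2+C/t}$ for all $n$ (the conjecture of Dellamonica et al. on small 2-regular subhypergraphs). -/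

import Mathlib

namespace Hypergraph

/-- Every edge has exactly `k` vertices (a `k`-graph). -/
def IsUniform {α : Type*} (H : Hypergraph α) (k : ℕ) : Prop :=
  ∀ e ∈ H.edgeSet, e.encard = k

/-- Any two distinct edges meet in at most one vertex. -/
def IsLinear {α : Type*} (H : Hypergraph α) : Prop :=
  ∀ e ∈ H.edgeSet, ∀ f ∈ H.edgeSet, e ≠ f → (e ∩ f).encard ≤ 1

/-- `H` is a linear 3-graph with exactly `n` vertices. -/
structure IsLinearThreeGraph {α : Type*} (H : Hypergraph α) (n : ℕ) : Prop where
  encard_vertexSet : H.vertexSet.encard = n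
  uniform : H.IsUniform 3
  linear : H.IsLinear

/-- The degree of a vertex: the number of edges containing it. -/
noncomputable def degree {α : Type*} (H : Hypergraph α) (v : α) : ℕ∞ :=
  {e ∈ H.edgeSet | v ∈ e}.encard

/-- A non-empty hypergraph (one with at least one edge) is `r`-regular if each of its vertices
has degree `r`. -/
def IsRegular {α : Type*} (H : Hypergraph α) (r : ℕ) : Prop :=
  H.edgeSet.Nonempty ∧ ∀ v ∈ H.vertexSet, H.degree v = r

/-- `F` is a (not necessarily induced or spanning) subhypergraph of `H`. -/
def IsSubhypergraph {α : Type*} (F H : Hypergraph α) : Prop :=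
  F.vertexSet ⊆ H.vertexSet ∧ F.edgeSet ⊆ H.edgeSet

/-- The possible numbers of edges of an `n`-vertex linear 3-graph (on the vertex set `Fin n`) which
contains no 2-regular subhypergraph with at most `t` edges. -/
def twoRegularFreeSizes (n t : ℕ) : Set ℕ :=
  {m | ∃ H : Hypergraph (Fin n), H.IsLinearThreeGraph n ∧ H.edgeSet.encard = m ∧
    ¬ ∃ F : Hypergraph (Fin n), F.IsSubhypergraph H ∧ F.IsRegular 2 ∧ F.edgeSet.encard ≤ t}

/-- The extremal number `f(n; t)`: the maximum number of edges in an `n`-vertex linear 3-graph which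
contains no 2-regular subhypergraph with at most `t` edges. -/
noncomputable def exTwoRegular (n t : ℕ) : ℕ :=
  sSup (twoRegularFreeSizes n t)

/-- The supremum defining `f(n; t)` is a genuine maximum. -/
theorem isGreatest_exTwoRegular (n t : ℕ) :
    IsGreatest (twoRegularFreeSizes n t) (exTwoRegular n t) := by
  have hne : (twoRegularFreeSizes n t).Nonempty := by
    refine ⟨0, trivialOn Set.univ, ⟨by simp, ?_, ?_⟩, by simp, ?_⟩
    · intro e he
      simp at he
    · intro e he
      simp at he
    · rintro ⟨F, hF, ⟨⟨e, he⟩, -⟩, -⟩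
      have := hF.2 he
      simp at this
  have hbdd : BddAbove (twoRegularFreeSizes n t) := by
    refine ⟨Nat.card (Set (Fin n)), ?_⟩
    rintro m ⟨H, -, hm, -⟩
    have h : H.edgeSet.ncard = m := by simp [Set.ncard, hm]
    rw [← h]
    exact Set.ncard_le_card _
  exact ⟨Nat.sSup_mem hne hbdd, fun m hm => le_csSup hbdd hm⟩

end Hypergraph

/-! Let S be the vertex set, of size n. Join ordered pairs (b, b') and (c, c') when distinct edges
abc and ab'c' meet at some a. By Cauchy–Schwarz this auxiliary graph on n² vertices has about τ²/n
adjacent ordered pairs, where τ counts ordered edges. Each step of a walk carries three vertices of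
the 3-graph: the two coordinates of its starting pair and the common vertex a. A closed walk of
length 2ℓ whose 6ℓ attached vertices are all distinct is a 2-regular subhypergraph with 4ℓ edges.

Such a walk comes from a spectral count (`exists_closedWalk_not_bad`). Linearity lets a walk on ℓ +
1 pairs conflict with at most s = 9ℓ predecessors of its first pair. Let δ be the average degree and
g(j) = tr M^(2j), with M the degree-normalised adjacency matrix. If every closed walk had a
conflict, `sum_bad_closedWalkWeight_le` would give g(ℓ) ≤ (16ℓ²s/δ) g(ℓ - 1). Log-convexity spreads
this down to g(0) = n², while a test vector gives g(ℓ) ≥ 4^(-ℓ). These clash once δ^ℓ > (64ℓ²s)^ℓ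
n², which is the stated edge density. -/

/-! ### Weighted closed walks and powers of symmetric matrices. -/

section ClosedWalks

open Finset Matrix

variable {V : Type*}

/-- The product of the entries of `M` along the walk `x 0, x 1, …, x n`. -/
def walkWeight (M : Matrix V V ℝ) {n : ℕ} (x : Fin (n + 1) → V) : ℝ :=
  ∏ i : Fin n, M (x i.castSucc) (x i.succ)

/-- The product of the entries of `M` along the closed walk `x 0, x 1, …, x n, x 0`. -/
def closedWalkWeight (M : Matrix V V ℝ) {n : ℕ} (x : Fin (n + 1) → V) : ℝ :=
  ∏ i : Fin (n + 1), M (x i) (x (i + 1))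

theorem walkWeight_nonneg {M : Matrix V V ℝ} (hM : ∀ a b, 0 ≤ M a b) {n : ℕ}
    (x : Fin (n + 1) → V) : 0 ≤ walkWeight M x :=
  prod_nonneg fun _ _ => hM _ _

theorem closedWalkWeight_eq (M : Matrix V V ℝ) {n : ℕ} (x : Fin (n + 1) → V) :
    closedWalkWeight M x = walkWeight M x * M (x (Fin.last n)) (x 0) := by
  rw [closedWalkWeight, walkWeight, Fin.prod_univ_castSucc]
  simp

theorem closedWalkWeight_rotate (M : Matrix V V ℝ) {n : ℕ} (x : Fin (n + 1) → V)
    (j : Fin (n + 1)) : closedWalkWeight M (fun i => x (i + j)) = closedWalkWeight M x := by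
  unfold closedWalkWeight
  refine Fintype.prod_equiv (Equiv.addRight j) _ _ fun i => ?_
  simp [add_right_comm]

theorem walkWeight_snoc (M : Matrix V V ℝ) {n : ℕ} (x : Fin (n + 1) → V) (z : V) :
    walkWeight M (Fin.snoc x z : Fin (n + 2) → V) = walkWeight M x * M (x (Fin.last n)) z := by
  rw [walkWeight, walkWeight, Fin.prod_univ_castSucc]
  congr 1
  · refine prod_congr rfl fun i _ => ?_
    rw [Fin.snoc_castSucc, ← Fin.castSucc_succ, Fin.snoc_castSucc]
  · rw [Fin.snoc_castSucc, Fin.succ_last, Fin.snoc_last]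

variable [Fintype V] [DecidableEq V]

/-- Summing the weights of all walks with a prescribed initial segment and a prescribed end. -/
theorem sum_walkWeight_mul (M : Matrix V V ℝ) (p q : ℕ) (φ : (Fin (p + 1) → V) → V → ℝ) :
    ∑ x : Fin (p + q + 1) → V, walkWeight M x *
        φ (fun i => x (Fin.castLE (by omega) i)) (x (Fin.last _)) =
      ∑ u : Fin (p + 1) → V, ∑ z, walkWeight M u * (M ^ q) (u (Fin.last p)) z * φ u z := by
  induction q generalizing φ with
  | zero =>
    refine sum_congr rfl fun u _ => ?_
    simp [Matrix.one_apply]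
  | succ q ih =>
    have h := (Fin.snocEquiv fun _ : Fin (p + q + 2) => V).sum_comp
      (fun x : Fin (p + q + 2) → V => walkWeight M x *
        φ (fun i => x (Fin.castLE (by omega) i)) (x (Fin.last _)))
    refine h.symm.trans ?_
    rw [Fintype.sum_prod_type_right]
    have h2 := ih fun u w => ∑ z, M w z * φ u z
    trans ∑ x : Fin (p + q + 1) → V, walkWeight M x *
        ∑ z, M (x (Fin.last _)) z * φ (fun i => x (Fin.castLE (by omega) i)) z
    · refine sum_congr rfl fun x _ => ?_
      rw [mul_sum]
      refine sum_congr rfl fun z _ => ?_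
      have hx : (Fin.snocEquiv fun _ : Fin (p + q + 2) => V) (z, x) = Fin.snoc x z := rfl
      simp only [hx, walkWeight_snoc, Fin.snoc_last, mul_assoc]
      congr 3
      funext i
      have : (Fin.castLE (by omega) i : Fin (p + q + 2)) =
        (Fin.castLE (by omega) i : Fin (p + q + 1)).castSucc := rfl
      rw [this, Fin.snoc_castSucc]
    · rw [h2]
      refine sum_congr rfl fun u _ => ?_
      simp_rw [mul_sum]
      rw [sum_comm]
      refine sum_congr rfl fun z _ => ?_
      rw [pow_succ, Matrix.mul_apply, mul_sum, sum_mul]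
      exact sum_congr rfl fun w _ => by ring

theorem sum_walkWeight_mul_ends (M : Matrix V V ℝ) (p : ℕ) (ψ : V → V → ℝ) :
    ∑ u : Fin (p + 1) → V, walkWeight M u * ψ (u 0) (u (Fin.last p)) =
      ∑ a, ∑ b, (M ^ p) a b * ψ a b := by
  have h := sum_walkWeight_mul M 0 p fun u z => ψ (u 0) z
  rw [← (Equiv.funUnique (Fin 1) V).symm.sum_comp] at h
  have e : 0 + p = p := zero_add p
  have key : ∀ q, q = p → (∑ x : Fin (q + 1) → V, walkWeight M x *
      ψ (x 0) (x (Fin.last _)) = ∑ a, ∑ b, (M ^ p) a b * ψ a b) →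
      ∑ u : Fin (p + 1) → V, walkWeight M u * ψ (u 0) (u (Fin.last p)) =
      ∑ a, ∑ b, (M ^ p) a b * ψ a b := by
    rintro q rfl h
    exact h
  refine key _ e ?_
  convert h using 4
  all_goals simp [walkWeight]

/-- The squared Frobenius norm of `M ^ j * X`. -/
def powNormSq {W : Type*} [Fintype W] (M : Matrix V V ℝ) (X : Matrix V W ℝ) (j : ℕ) : ℝ :=
  ∑ a, ∑ c, ((M ^ j * X) a c) ^ 2

/-- Symmetry moves one factor `M` across the inner product: ‖M^(j+1) X‖² = ⟨M^j X, M^(j+2) X⟩.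
Cauchy–Schwarz finishes. -/
theorem powNormSq_sq_le {W : Type*} [Fintype W] {M : Matrix V V ℝ} (hM : Mᵀ = M)
    (X : Matrix V W ℝ) (j : ℕ) :
    powNormSq M X (j + 1) ^ 2 ≤ powNormSq M X j * powNormSq M X (j + 2) := by
  have h1 : powNormSq M X (j + 1) =
      ∑ p : V × W, (M ^ j * X) p.1 p.2 * (M ^ (j + 2) * X) p.1 p.2 := by
    have h3 : ∀ Y Z : Matrix V W ℝ, trace (Yᵀ * Z) = ∑ a, ∑ c, Y a c * Z a c := by
      intro Y Z
      rw [Matrix.trace, sum_comm]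
      simp [Matrix.mul_apply]
    rw [Fintype.sum_prod_type]
    refine Eq.trans ?_ (h3 (M ^ j * X) (M ^ (j + 2) * X))
    have h4 : powNormSq M X (j + 1) = trace ((M ^ (j + 1) * X)ᵀ * (M ^ (j + 1) * X)) := by
      rw [h3]
      exact sum_congr rfl fun a _ => sum_congr rfl fun c _ => pow_two _
    rw [h4]
    have h5 : M ^ (j + 1) * (M ^ (j + 1) * X) = M ^ j * (M ^ (j + 2) * X) := by
      rw [← Matrix.mul_assoc, ← Matrix.mul_assoc, ← pow_add, ← pow_add]
      congr 2
      ring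
    simp only [Matrix.transpose_mul, Matrix.transpose_pow, hM, Matrix.mul_assoc, h5]
  rw [h1]
  refine (sum_mul_sq_le_sq_mul_sq _ _ _).trans_eq ?_
  simp [powNormSq, Fintype.sum_prod_type]

/-- Log-convexity makes the ratios g(j+1)/g(j) nondecreasing, so an upper bound on one ratio holds
for all earlier ones. -/
theorem le_pow_mul_of_logConvex {g : ℕ → ℝ} (hg : ∀ j, 0 < g j)
    (hc : ∀ j, g (j + 1) ^ 2 ≤ g j * g (j + 2)) {C : ℝ} {m : ℕ} (h : g (m + 1) ≤ C * g m) :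
    g (m + 1) ≤ C ^ (m + 1) * g 0 := by
  have hC : 0 < C := pos_of_mul_pos_left ((hg _).trans_le h) (hg m).le
  have key : ∀ m, g (m + 1) ≤ C * g m → g (m + 1) ≤ C ^ (m + 1) * g 0 := by
    intro m
    induction m with
    | zero => intro h; simpa using h
    | succ m ih =>
      intro h
      have h1 : g (m + 1) ≤ C * g m := by
        have h2 := hc m
        have h3 := mul_le_mul_of_nonneg_left h (hg m).le
        refine le_of_mul_le_mul_right ?_ (hg (m + 1))
        nlinarith
      calc g (m + 1 + 1) ≤ C * g (m + 1) := h
        _ ≤ C * (C ^ (m + 1) * g 0) := mul_le_mul_of_nonneg_left (ih h1) hC.le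
        _ = _ := by ring
  exact key m h

/-- The opposite direction: a lower bound on the first ratio passes to all later ones. Only `g 0` is
assumed positive, so positivity is carried through the induction. -/
theorem pow_mul_le_of_logConvex {g : ℕ → ℝ} (h0 : 0 < g 0)
    (hc : ∀ j, g (j + 1) ^ 2 ≤ g j * g (j + 2)) {c : ℝ} (hpos : 0 < c) (h : c * g 0 ≤ g 1) (m : ℕ) :
    0 < g m ∧ c * g m ≤ g (m + 1) ∧ c ^ m * g 0 ≤ g m := by
  induction m with
  | zero => simpa using ⟨h0, h⟩
  | succ m ih =>
    obtain ⟨i1, i2, i3⟩ := ih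
    have j1 : 0 < g (m + 1) := lt_of_lt_of_le (by positivity) i2
    refine ⟨j1, ?_, ?_⟩
    · have h2 := hc m
      refine le_of_mul_le_mul_left ?_ i1
      nlinarith
    · calc c ^ (m + 1) * g 0 = c * (c ^ m * g 0) := by ring
        _ ≤ c * g m := mul_le_mul_of_nonneg_left i3 hpos.le
        _ ≤ _ := i2

theorem walkWeight_le_pow_apply {M : Matrix V V ℝ} (hM : ∀ a b, 0 ≤ M a b) {p : ℕ}
    (u : Fin (p + 1) → V) : walkWeight M u ≤ (M ^ p) (u 0) (u (Fin.last p)) := by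
  have h := sum_walkWeight_mul_ends M p
    fun a b => if a = u 0 then (if b = u (Fin.last p) then (1 : ℝ) else 0) else 0
  have h2 : ∑ a, ∑ b, (M ^ p) a b *
      (if a = u 0 then (if b = u (Fin.last p) then (1 : ℝ) else 0) else 0) =
        (M ^ p) (u 0) (u (Fin.last p)) := by
    simp [mul_ite]
  rw [← h2, ← h]
  refine le_trans ?_ (single_le_sum (fun v _ => ?_) (mem_univ u))
  · simp
  · refine mul_nonneg (walkWeight_nonneg hM v) ?_
    split_ifs <;> norm_num

/-- Both sides equal the trace of `M ^ (2 * (m + 1))`. -/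
theorem sum_closedWalkWeight {M : Matrix V V ℝ} (hM : Mᵀ = M) (m : ℕ) :
    ∑ x : Fin (m + 1 + m + 1) → V, closedWalkWeight M x = powNormSq M (1 : Matrix V V ℝ) (m + 1) := by
  simp_rw [closedWalkWeight_eq]
  rw [sum_walkWeight_mul_ends M (m + 1 + m) fun a b => M b a]
  have h1 : ∀ a, ∑ b, (M ^ (m + 1 + m)) a b * M b a =
      ∑ b, ((M ^ (m + 1) * 1 : Matrix V V ℝ) a b) ^ 2 := by
    intro a
    rw [← Matrix.mul_apply, ← pow_succ, add_assoc, pow_add, Matrix.mul_apply]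
    refine sum_congr rfl fun b _ => ?_
    rw [Matrix.mul_one, sq]
    congr 1
    conv_lhs => rw [← hM, ← Matrix.transpose_pow, Matrix.transpose_apply]
  exact sum_congr rfl fun a _ => h1 a

/-- If every walk on `m + 2` vertices has few bad predecessors of its first vertex, then the
closed walks of length `2 * (m + 1)` closing up through a bad predecessor have small weight. -/
theorem sum_bad_closedWalkWeight_le {M : Matrix V V ℝ} (hM0 : ∀ a b, 0 ≤ M a b) {m : ℕ}
    (R : (Fin (m + 1 + 1) → V) → V → Prop) [∀ u z, Decidable (R u z)] {t : V → V → ℝ}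
    (ht : ∀ a b, 0 < t a b) {σ : ℝ}
    (hσ : ∀ u, walkWeight M u ≠ 0 → ∑ z, (if R u z then M z (u 0) * t z (u 0) else 0) ≤ σ)
    (hdiv : ∀ z, ∑ a, M z a / t z a ≤ 1) {lam : ℝ} (hlam : 0 < lam) :
    ∑ x : Fin (m + 1 + m + 1) → V,
        (if R (fun i => x (Fin.castLE (by omega) i)) (x (Fin.last _))
          then closedWalkWeight M x else 0) ≤
      lam * σ * powNormSq M (1 : Matrix V V ℝ) (m + 1) + lam⁻¹ * powNormSq M (1 : Matrix V V ℝ) m := by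
  have h1 := sum_walkWeight_mul M (m + 1) m fun u z => if R u z then M z (u 0) else 0
  have h2 : ∑ x : Fin (m + 1 + m + 1) → V,
        (if R (fun i => x (Fin.castLE (by omega) i)) (x (Fin.last _))
          then closedWalkWeight M x else 0) =
      ∑ x : Fin (m + 1 + m + 1) → V, walkWeight M x *
        (if R (fun i => x (Fin.castLE (by omega) i)) (x (Fin.last _))
          then M (x (Fin.last _)) (x 0) else 0) := by
    refine sum_congr rfl fun x _ => ?_
    rw [closedWalkWeight_eq, mul_ite, mul_zero]
  rw [h2]
  refine h1.trans_le ?_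
  set K : V → V → ℝ := fun a b => (M ^ (m + 1)) a b with hK
  -- The return factor (M^m)(u_last, z) is split by AM-GM against B = λ · K · t, where `K` is the
  -- total weight of walks with the ends of `u`. The first part sees the restriction `R`; the second
  -- drops it.
  have hterm : ∀ u : Fin (m + 1 + 1) → V, ∀ z,
      walkWeight M u * (M ^ m) (u (Fin.last _)) z * (if R u z then M z (u 0) else 0) ≤
        lam * (walkWeight M u * K (u 0) (u (Fin.last _))) *
            (if R u z then M z (u 0) * t z (u 0) else 0) +
          walkWeight M u * (lam⁻¹ * ((M ^ m) (u (Fin.last _)) z) ^ 2 *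
            (M z (u 0) / t z (u 0)) / K (u 0) (u (Fin.last _))) := by
    intro u z
    rcases (walkWeight_nonneg hM0 u).eq_or_lt with h0 | h0
    · simp [← h0]
    have hKpos : 0 < K (u 0) (u (Fin.last _)) := h0.trans_le (walkWeight_le_pow_apply hM0 u)
    have htp := ht z (u 0)
    have hMz := hM0 z (u 0)
    split_ifs with hR
    · have key : (M ^ m) (u (Fin.last _)) z ≤ lam * K (u 0) (u (Fin.last _)) * t z (u 0) +
          ((M ^ m) (u (Fin.last _)) z) ^ 2 / (lam * K (u 0) (u (Fin.last _)) * t z (u 0)) := by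
        have hB : 0 < lam * K (u 0) (u (Fin.last _)) * t z (u 0) := by positivity
        generalize lam * K (u 0) (u (Fin.last _)) * t z (u 0) = B at hB
        generalize (M ^ m) (u (Fin.last _)) z = a
        rw [← sub_le_iff_le_add', le_div_iff₀ hB]
        nlinarith [sq_nonneg (a - B), sq_nonneg a, sq_nonneg B, sq_nonneg (a + B)]
      calc _ = walkWeight M u * M z (u 0) * (M ^ m) (u (Fin.last _)) z := by ring
        _ ≤ walkWeight M u * M z (u 0) * _ :=
          mul_le_mul_of_nonneg_left key (mul_nonneg h0.le hMz)
        _ = _ := by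
          field_simp
    · rw [mul_zero, mul_zero, zero_add]
      positivity
  refine (sum_le_sum fun u _ => sum_le_sum fun z _ => hterm u z).trans ?_
  simp_rw [sum_add_distrib]
  refine add_le_add ?_ ?_
  · calc _ ≤ ∑ u : Fin (m + 1 + 1) → V,
          walkWeight M u * (lam * σ * K (u 0) (u (Fin.last _))) := by
          refine sum_le_sum fun u _ => ?_
          rw [← mul_sum]
          by_cases h0 : walkWeight M u = 0
          · simp [h0]
          · have h3 : 0 ≤ lam * (walkWeight M u * K (u 0) (u (Fin.last _))) :=
              mul_nonneg hlam.le (mul_nonneg (walkWeight_nonneg hM0 u)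
                (pow_apply_nonneg hM0 _ _ _))
            calc _ ≤ lam * (walkWeight M u * K (u 0) (u (Fin.last _))) * σ :=
                  mul_le_mul_of_nonneg_left (hσ u h0) h3
              _ = _ := by ring
      _ = ∑ a, ∑ b, (M ^ (m + 1)) a b * (lam * σ * K a b) :=
          sum_walkWeight_mul_ends M (m + 1) fun a b => lam * σ * K a b
      _ = _ := by
          simp_rw [powNormSq, Matrix.mul_one, mul_sum, hK]
          exact sum_congr rfl fun a _ => sum_congr rfl fun b _ => by ring
  -- Summing over walks with fixed ends a, b produces a factor K(a, b), which cancels the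
  -- denominator and leaves only entries of M^m.
  · rw [sum_comm]
    calc _ = ∑ z, ∑ a, ∑ b, (M ^ (m + 1)) a b *
          (lam⁻¹ * ((M ^ m) b z) ^ 2 * (M z a / t z a) / K a b) := by
          refine sum_congr rfl fun z _ => ?_
          exact sum_walkWeight_mul_ends M (m + 1) fun a b =>
            lam⁻¹ * ((M ^ m) b z) ^ 2 * (M z a / t z a) / K a b
      _ ≤ ∑ z, ∑ a, ∑ b, (lam⁻¹ * ((M ^ m) b z) ^ 2) * (M z a / t z a) := by
          refine sum_le_sum fun z _ => sum_le_sum fun a _ => sum_le_sum fun b _ => ?_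
          have h3 : 0 ≤ lam⁻¹ * ((M ^ m) b z) ^ 2 * (M z a / t z a) :=
            mul_nonneg (by positivity) (div_nonneg (hM0 _ _) (ht _ _).le)
          rcases (pow_apply_nonneg hM0 (m + 1) a b).eq_or_lt with h0 | h0
          · rw [← h0, zero_mul]
            exact h3
          · exact (mul_div_cancel₀ _ h0.ne').le
      _ = ∑ z, ∑ b, (lam⁻¹ * ((M ^ m) b z) ^ 2) * ∑ a, (M z a / t z a) := by
          refine sum_congr rfl fun z _ => ?_
          rw [sum_comm]
          exact sum_congr rfl fun b _ => (mul_sum _ _ _).symm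
      _ ≤ ∑ z, ∑ b, (lam⁻¹ * ((M ^ m) b z) ^ 2) := by
          refine sum_le_sum fun z _ => sum_le_sum fun b _ => ?_
          exact mul_le_of_le_one_right (by positivity) (hdiv z)
      _ = _ := by
          rw [sum_comm]
          simp_rw [powNormSq, Matrix.mul_one, mul_sum]

/-- If the number `D` of adjacent ordered pairs is large, and if every walk on `m + 2` vertices has
at most `s` bad predecessors of its first vertex, then some closed walk of length `2 * (m + 1)`
contains no bad predecessor of any of its subwalks on `m + 2` vertices. -/
theorem exists_closedWalk_not_bad {A : V → V → Prop} (hA : ∀ a b, A a b → A b a) {m s : ℕ}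
    (hs0 : 0 < s) (R : (Fin (m + 1 + 1) → V) → V → Prop)
    (hs : ∀ u : Fin (m + 1 + 1) → V, (∀ i : Fin (m + 1), A (u i.castSucc) (u i.succ)) →
      {z | A z (u 0) ∧ R u z}.ncard ≤ s)
    (hD : (64 * ((m : ℝ) + 1) ^ 2 * s) ^ (m + 1) * Fintype.card V <
      ({p : V × V | A p.1 p.2}.ncard / Fintype.card V : ℝ) ^ (m + 1)) :
    ∃ x : Fin (m + 1 + m + 1) → V, (∀ i, A (x i) (x (i + 1))) ∧
      ∀ j, ¬ R (fun i => x (Fin.castLE (by omega) i + j)) (x (Fin.last _ + j)) := by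
  classical
  set N : ℝ := (Fintype.card V : ℝ) with hN
  set δ : ℝ := ({p : V × V | A p.1 p.2}.ncard / N : ℝ) with hδ
  have hs1 : (0 : ℝ) < s := by exact_mod_cast hs0
  have hδ0 : 0 < δ := by
    have h0 : 0 ≤ δ := by positivity
    rcases h0.eq_or_lt with h | h
    · rw [← h, zero_pow (by omega)] at hD
      exact absurd hD (not_lt.2 (by positivity))
    · exact h
  have hN0 : 0 < N := by
    rcases (show 0 ≤ N from Nat.cast_nonneg _).eq_or_lt with h | h
    · rw [hδ, ← h, div_zero] at hδ0
      exact absurd hδ0 (lt_irrefl _)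
    · exact h
  set d : V → ℝ := fun a => ∑ b, if A a b then (1 : ℝ) else 0 with hd
  have hd0 : ∀ a, 0 ≤ d a := fun a => sum_nonneg fun b _ => by split_ifs <;> norm_num
  have hdsum : ∑ a, d a = N * δ := by
    rw [hδ, mul_div_cancel₀ _ hN0.ne', hd, ← Fintype.sum_prod_type', Set.ncard_eq_toFinset_card']
    simp
  -- Adding the average degree δ keeps every normalising factor at least √δ, so no passage to a
  -- subgraph of large minimum degree is needed.
  set v : V → ℝ := fun a => √(d a + δ) with hv
  have hv0 : ∀ a, 0 < v a := fun a => Real.sqrt_pos.2 (by linarith [hd0 a])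
  have hvsq : ∀ a, v a ^ 2 = d a + δ := fun a => Real.sq_sqrt (by linarith [hd0 a])
  set M : Matrix V V ℝ := Matrix.of fun a b => if A a b then (v a)⁻¹ * (v b)⁻¹ else 0 with hM
  have hMapp : ∀ a b, M a b = if A a b then (v a)⁻¹ * (v b)⁻¹ else 0 := fun a b => rfl
  have hMsymm : Mᵀ = M := by
    ext a b
    rw [Matrix.transpose_apply, hMapp, hMapp, mul_comm]
    exact if_congr ⟨hA _ _, hA _ _⟩ rfl rfl
  have hM0 : ∀ a b, 0 ≤ M a b := by
    intro a b
    rw [hMapp]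
    have := hv0 a
    have := hv0 b
    split_ifs <;> positivity
  -- the lower bound on the total weight
  set g : ℕ → ℝ := powNormSq M (1 : Matrix V V ℝ) with hg
  -- Test vector: ‖v‖² = 2Nδ and (Mv)_a = d_a / v_a.
  set X : Matrix V Unit ℝ := Matrix.of fun a _ => v a with hX
  have hX0 : powNormSq M X 0 = 2 * (N * δ) := by
    have h1 : powNormSq M X 0 = ∑ a, (d a + δ) := by
      rw [powNormSq]
      refine sum_congr rfl fun a _ => ?_
      rw [univ_unique, sum_singleton, pow_zero, Matrix.one_mul, hX, Matrix.of_apply, hvsq]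
    rw [h1, sum_add_distrib, hdsum, sum_const, card_univ, nsmul_eq_mul, ← hN]
    ring
  have hX1 : 1 / 4 * powNormSq M X 0 ≤ powNormSq M X 1 := by
    have h1 : ∀ a, (M ^ 1 * X : Matrix V Unit ℝ) a () = d a * (v a)⁻¹ := by
      intro a
      rw [pow_one, Matrix.mul_apply, hd, sum_mul]
      refine sum_congr rfl fun b _ => ?_
      rw [hMapp, hX, Matrix.of_apply]
      split_ifs
      · field_simp [(hv0 a).ne', (hv0 b).ne']
      · simp
    -- After clearing the denominator this is (d_a - (d_a + δ)/2)² ≥ 0.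
    have h2 : ∀ a, d a - (d a + δ) / 4 ≤ (d a * (v a)⁻¹) ^ 2 := by
      intro a
      have h3 : 0 < d a + δ := by linarith [hd0 a]
      rw [mul_pow, inv_pow, hvsq, ← div_eq_mul_inv, le_div_iff₀ h3]
      nlinarith [sq_nonneg (d a - δ), sq_nonneg (d a - (d a + δ) / 2)]
    have h4 : ∑ a, (d a - (d a + δ) / 4) ≤ powNormSq M X 1 := by
      rw [powNormSq]
      refine sum_le_sum fun a _ => ?_
      rw [univ_unique, sum_singleton]
      exact (h2 a).trans_eq (by rw [← h1])
    rw [hX0]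
    refine le_trans (le_of_eq ?_) h4
    rw [sum_sub_distrib, ← sum_div, sum_add_distrib, hdsum, sum_const, card_univ, nsmul_eq_mul,
      ← hN]
    ring
  have hX0pos : 0 < powNormSq M X 0 := by rw [hX0]; positivity
  have hXj := pow_mul_le_of_logConvex hX0pos (powNormSq_sq_le hMsymm X)
    (by norm_num : (0 : ℝ) < 1 / 4) hX1
  -- Cauchy–Schwarz gives ‖M^j X‖² ≤ ‖M^j‖² ‖X‖² in Frobenius norm.
  have hgj : ∀ j, (1 / 4 : ℝ) ^ j ≤ g j := by
    intro j
    refine le_of_mul_le_mul_right ((hXj j).2.2.trans ?_) hX0pos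
    rw [hg, powNormSq, powNormSq, sum_mul]
    refine sum_le_sum fun a _ => ?_
    rw [univ_unique, sum_singleton, Matrix.mul_apply]
    refine (sum_mul_sq_le_sq_mul_sq _ _ _).trans_eq ?_
    simp [powNormSq]
  have hgpos : ∀ j, 0 < g j := fun j => lt_of_lt_of_le (by positivity) (hgj j)
  by_contra hcon
  push Not at hcon
  -- the upper bound on the weight of the bad closed walks
  set B : ℝ := ∑ x : Fin (m + 1 + m + 1) → V,
        (if R (fun i => x (Fin.castLE (by omega) i)) (x (Fin.last _))
          then closedWalkWeight M x else 0) with hB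
  have hcw0 : ∀ x : Fin (m + 1 + m + 1) → V, 0 ≤ closedWalkWeight M x :=
    fun x => prod_nonneg fun _ _ => hM0 _ _
  -- Union bound over the 2(m + 1) rotations, which all contribute the same sum `B`.
  have hgB : g (m + 1) ≤ (2 * (m + 1)) * B := by
    have hrot : ∀ j : Fin (m + 1 + m + 1), ∑ x : Fin (m + 1 + m + 1) → V,
        (if R (fun i => x (Fin.castLE (by omega) i + j)) (x (Fin.last _ + j))
          then closedWalkWeight M x else 0) = B := by
      intro j
      refine Fintype.sum_equiv (Equiv.arrowCongr (Equiv.subRight j) (Equiv.refl V)) _ _ fun x => ?_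
      have hx : (Equiv.arrowCongr (Equiv.subRight j) (Equiv.refl V)) x = fun i => x (i + j) := by
        funext i
        simp
      rw [hx, closedWalkWeight_rotate]
    calc g (m + 1) = ∑ x : Fin (m + 1 + m + 1) → V, closedWalkWeight M x :=
          (sum_closedWalkWeight hMsymm m).symm
      _ ≤ ∑ x : Fin (m + 1 + m + 1) → V, ∑ j,
          (if R (fun i => x (Fin.castLE (by omega) i + j)) (x (Fin.last _ + j))
            then closedWalkWeight M x else 0) := by
          refine sum_le_sum fun x _ => ?_
          have hnn : ∀ j ∈ (univ : Finset (Fin (m + 1 + m + 1))), 0 ≤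
              (if R (fun i => x (Fin.castLE (by omega) i + j)) (x (Fin.last _ + j))
                then closedWalkWeight M x else 0) := by
            intro j _
            split_ifs
            exacts [hcw0 x, le_rfl]
          by_cases hx : ∀ i, A (x i) (x (i + 1))
          · obtain ⟨j, hj⟩ := hcon x hx
            refine le_trans ?_ (single_le_sum hnn (mem_univ j))
            rw [if_pos hj]
          · push Not at hx
            obtain ⟨i, hi⟩ := hx
            have h0 : closedWalkWeight M x = 0 :=
              prod_eq_zero (mem_univ i) (by rw [hMapp, if_neg hi])
            exact h0.trans_le (sum_nonneg hnn)
      _ = ∑ j : Fin (m + 1 + m + 1), B := by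
          rw [sum_comm]
          exact sum_congr rfl fun j _ => hrot j
      _ = _ := by
          rw [sum_const, card_univ, Fintype.card_fin, nsmul_eq_mul]
          push_cast
          ring
  -- With t(z, a) = v_z / v_a, each M·t is at most 1/v_a² ≤ 1/δ, so `s` bad predecessors cost s/δ,
  -- while the sum of M/t over a is d_z / v_z² ≤ 1. The value of `lam` gives the g(m+1) term
  -- coefficient 1/2 after multiplication by 2(m + 1), so it can be absorbed.
  have hbad := sum_bad_closedWalkWeight_le hM0 R (t := fun z a => v z / v a)
    (fun a b => div_pos (hv0 a) (hv0 b)) (σ := s / δ) (by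
      intro u hu
      have hadj : ∀ i : Fin (m + 1), A (u i.castSucc) (u i.succ) := by
        intro i
        by_contra hi
        exact hu (prod_eq_zero (mem_univ i) (by rw [hMapp, if_neg hi]))
      calc _ ≤ ∑ z, (if A z (u 0) ∧ R u z then δ⁻¹ else 0) := by
            refine sum_le_sum fun z _ => ?_
            rw [hMapp]
            by_cases h1 : R u z <;> by_cases h2 : A z (u 0) <;> simp only [h1, h2, if_true,
              if_false, and_self, and_true, and_false, zero_mul, le_refl]
            have h3 : (v z)⁻¹ * (v (u 0))⁻¹ * (v z / v (u 0)) = (v (u 0) ^ 2)⁻¹ := by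
              field_simp [(hv0 z).ne', (hv0 (u 0)).ne']
            rw [h3, hvsq]
            exact inv_anti₀ hδ0 (by linarith [hd0 (u 0)])
        _ = {z | A z (u 0) ∧ R u z}.ncard * δ⁻¹ := by
            rw [← sum_filter, sum_const, nsmul_eq_mul, Set.ncard_eq_toFinset_card']
            simp
        _ ≤ s * δ⁻¹ := by
            have := hs u hadj
            gcongr
        _ = _ := (div_eq_mul_inv _ _).symm) (by
      intro z
      calc _ = ∑ a, (if A z a then (1 : ℝ) else 0) * (v z ^ 2)⁻¹ := by
            refine sum_congr rfl fun a _ => ?_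
            rw [hMapp]
            split_ifs
            · field_simp [(hv0 z).ne', (hv0 a).ne']
            · simp
        _ = d z * (v z ^ 2)⁻¹ := (sum_mul _ _ _).symm
        _ ≤ 1 := by
            rw [hvsq, ← div_eq_mul_inv, div_le_one (by linarith [hd0 z])]
            linarith) (lam := δ / (4 * (m + 1) * s)) (by positivity)
  have hfin : g (m + 1) ≤ (16 * (m + 1) ^ 2 * s / δ) * g m := by
    have h1 : g (m + 1) ≤ 2 * (m + 1) * (δ / (4 * (m + 1) * s) * (s / δ) * g (m + 1) +
        (δ / (4 * (m + 1) * s))⁻¹ * g m) :=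
      hgB.trans (mul_le_mul_of_nonneg_left hbad (by positivity))
    have h2 : 2 * ((m : ℝ) + 1) * (δ / (4 * (m + 1) * s) * (s / δ) * g (m + 1) +
        (δ / (4 * (m + 1) * s))⁻¹ * g m) =
        1 / 2 * g (m + 1) + 1 / 2 * ((16 * (m + 1) ^ 2 * s / δ) * g m) := by
      field_simp
      ring
    rw [h2] at h1
    linarith
  have hup := le_pow_mul_of_logConvex hgpos (powNormSq_sq_le hMsymm 1) hfin
  have hg0 : g 0 = N := by
    simp [hg, powNormSq, Matrix.one_apply, hN]
  have hlow := (hgj (m + 1)).trans hup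
  rw [hg0, div_pow (16 * ((m : ℝ) + 1) ^ 2 * s) δ] at hlow
  refine absurd hD (not_lt.2 ?_)
  have h3 : δ ^ (m + 1) * ((1 / 4 : ℝ) ^ (m + 1)) ≤ (16 * (m + 1) ^ 2 * s) ^ (m + 1) * N := by
    calc _ ≤ δ ^ (m + 1) * ((16 * (m + 1) ^ 2 * s) ^ (m + 1) / δ ^ (m + 1) * N) := by
          have : (0 : ℝ) ≤ δ ^ (m + 1) := by positivity
          gcongr
      _ = _ := by field_simp
  calc δ ^ (m + 1) = 4 ^ (m + 1) * (δ ^ (m + 1) * (1 / 4 : ℝ) ^ (m + 1)) := by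
        rw [mul_left_comm, ← mul_pow]
        norm_num
    _ ≤ 4 ^ (m + 1) * ((16 * (m + 1) ^ 2 * s) ^ (m + 1) * N) := by gcongr
    _ = _ := by
        rw [← mul_assoc, ← mul_pow]
        ring

end ClosedWalks

/-! ### The auxiliary graph on pairs of vertices of a linear 3-graph. -/

/-- A ternary relation describing the ordered edges of a linear 3-graph. -/
structure IsLinearTripleRel {S : Type*} (T : S → S → S → Prop) : Prop where
  swap_left : ∀ {a b c}, T a b c → T b a c
  swap_right : ∀ {a b c}, T a b c → T a c b
  ne : ∀ {a b c}, T a b c → a ≠ b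
  unique : ∀ {a b c c'}, T a b c → T a b c' → c = c'

/-- Two pairs of vertices are adjacent if they are matched by two edges with a common vertex. -/
def PairAdj {S : Type*} (T : S → S → S → Prop) (x y : S × S) : Prop :=
  x.1 ≠ x.2 ∧ y.1 ≠ x.2 ∧ ∃ a, T a x.1 y.1 ∧ T a x.2 y.2

open Classical in
/-- The vertices attached to a pair `x` followed by `y` on a walk: the coordinates of `x`, and the
common vertex of the two edges joining `x` to `y`. -/
noncomputable def pairVertex {S : Type*} (T : S → S → S → Prop) (x y : S × S) : Option Bool → S
  | none => if h : ∃ a, T a x.1 y.1 ∧ T a x.2 y.2 then h.choose else x.1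
  | some false => x.1
  | some true => x.2

namespace IsLinearTripleRel

open Finset

variable {S : Type*} {T : S → S → S → Prop}

theorem unique_left (hT : IsLinearTripleRel T) {a a' b c : S} (h : T a b c) (h' : T a' b c) :
    a = a' :=
  hT.unique (hT.swap_right (hT.swap_left h)) (hT.swap_right (hT.swap_left h'))

theorem unique_mid (hT : IsLinearTripleRel T) {a b b' c : S} (h : T a b c) (h' : T a b' c) :
    b = b' :=
  hT.unique (hT.swap_right h) (hT.swap_right h')

/-- The two inequalities in `PairAdj` say that the edges through the common vertex are distinct, a
condition symmetric in the two pairs by linearity. -/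
theorem pairAdj_symm (hT : IsLinearTripleRel T) {x y : S × S} (h : PairAdj T x y) :
    PairAdj T y x := by
  obtain ⟨h1, h2, a, h3, h4⟩ := h
  refine ⟨fun h => h1 ?_, fun h => h2 ?_, a, hT.swap_right h3, hT.swap_right h4⟩
  · rw [← h] at h4
    exact hT.unique_mid h3 h4
  · rw [h] at h3
    exact hT.unique h3 (hT.swap_right h4)

theorem pairVertex_none_spec {x y : S × S} (h : PairAdj T x y) :
    T (pairVertex T x y none) x.1 y.1 ∧ T (pairVertex T x y none) x.2 y.2 := by
  rw [pairVertex, dif_pos h.2.2]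
  exact h.2.2.choose_spec

/-- The successor `y'` is arbitrary because the `some` values depend only on the first pair. -/
theorem pairVertex_spec {x y : S × S} (h : PairAdj T x y) (β : Bool) (y' : S × S) :
    T (pairVertex T x y none) (pairVertex T x y (some β)) (pairVertex T y y' (some β)) := by
  cases β
  exacts [(pairVertex_none_spec h).1, (pairVertex_none_spec h).2]

theorem pairVertex_injective (hT : IsLinearTripleRel T) {x y : S × S} (h : PairAdj T x y) :
    Function.Injective (pairVertex T x y) := by
  obtain ⟨h1, h2⟩ := pairVertex_none_spec h
  rintro (_ | _ | _) (_ | _ | _) h3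
  · rfl
  · exact absurd h3 (hT.ne h1)
  · exact absurd h3 (hT.ne h2)
  · exact absurd h3.symm (hT.ne h1)
  · rfl
  · exact absurd h3 h.1
  · exact absurd h3.symm (hT.ne h2)
  · exact absurd h3.symm h.1
  · rfl

/-- Knowing `y` and one attached vertex fixes the common vertex, and then linearity fixes both
coordinates of `x`. This is what bounds the number of bad predecessors. -/
theorem eq_of_pairVertex_eq (hT : IsLinearTripleRel T) {x x' y : S × S} (h : PairAdj T x y)
    (h' : PairAdj T x' y) (β : Option Bool)
    (he : pairVertex T x y β = pairVertex T x' y β) : x = x' := by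
  obtain ⟨h1, h2⟩ := pairVertex_none_spec h
  obtain ⟨h1', h2'⟩ := pairVertex_none_spec h'
  have key : pairVertex T x y none = pairVertex T x' y none := by
    rcases β with _ | _ | _
    · exact he
    · change x.1 = x'.1 at he
      rw [← he] at h1'
      exact hT.unique_left h1 h1'
    · change x.2 = x'.2 at he
      rw [← he] at h2'
      exact hT.unique_left h2 h2'
  rw [← key] at h1' h2'
  exact Prod.ext (hT.unique_mid h1 h1') (hT.unique_mid h2 h2')

variable [Fintype S]

/-- The number of adjacent pairs is at least `τ ^ 2 / n - 2 * τ`, where `τ` is the number of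
ordered edges. -/
theorem le_ncard_pairAdj (hT : IsLinearTripleRel T) :
    ({q : S × S × S | T q.1 q.2.1 q.2.2}.ncard : ℝ) ^ 2 ≤ Fintype.card S *
      ({p : (S × S) × (S × S) | PairAdj T p.1 p.2}.ncard +
        2 * {q : S × S × S | T q.1 q.2.1 q.2.2}.ncard) := by
  classical
  set P : S → Finset (S × S) := fun a => univ.filter fun y => T a y.1 y.2 with hP
  set G : S → Finset ((S × S) × (S × S)) := fun a =>
    (P a ×ˢ P a).filter fun q => q.2.1 ≠ q.1.1 ∧ q.2.1 ≠ q.1.2 with hG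
  have hτ : {q : S × S × S | T q.1 q.2.1 q.2.2}.ncard = ∑ a, (P a).card := by
    rw [Set.ncard_eq_toFinset_card', ← card_sigma]
    refine card_bij (fun q _ => ⟨q.1, q.2⟩) ?_ ?_ ?_
    · intro q hq
      simpa [hP] using hq
    · rintro ⟨a, y⟩ _ ⟨b, z⟩ _ h
      simpa using h
    · rintro ⟨a, y⟩ h
      exact ⟨(a, y), by simpa [hP] using h, rfl⟩
  have hGle : ∑ a, (G a).card ≤ {p : (S × S) × (S × S) | PairAdj T p.1 p.2}.ncard := by
    rw [Set.ncard_eq_toFinset_card', ← card_sigma]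
    refine card_le_card_of_injOn
      (fun q : (_ : S) × ((S × S) × (S × S)) => ((q.2.1.1, q.2.2.1), (q.2.1.2, q.2.2.2))) ?_ ?_
    · rintro ⟨a, ⟨b, c⟩, ⟨b', c'⟩⟩ h
      simp only [hG, hP, coe_sigma, Set.mem_sigma_iff, mem_coe, mem_filter, mem_product,
        mem_univ, true_and] at h
      simp only [Set.coe_toFinset, Set.mem_ofPred_eq]
      exact ⟨Ne.symm h.2.1, Ne.symm h.2.2, a, h.1.1, h.1.2⟩
    · rintro ⟨a, ⟨b, c⟩, ⟨b', c'⟩⟩ h ⟨a₁, ⟨b₁, c₁⟩, ⟨b₁', c₁'⟩⟩ h' he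
      simp only [hG, hP, coe_sigma, Set.mem_sigma_iff, mem_coe, mem_filter, mem_product,
        mem_univ, true_and] at h h'
      simp only [Prod.mk.injEq] at he
      obtain ⟨⟨rfl, rfl⟩, rfl, rfl⟩ := he
      obtain rfl := hT.unique_left h.1.1 h'.1.1
      rfl
  -- A pair of edges excluded from `G a` is determined by its first member and by which inequality
  -- fails, so at most 2|P a| are lost.
  have hGcard : ∀ a, (P a).card ^ 2 ≤ (G a).card + 2 * (P a).card := by
    intro a
    have h1 : P a ×ˢ P a ⊆ G a ∪ ((P a ×ˢ P a).filter (fun q => q.2.1 = q.1.1) ∪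
        (P a ×ˢ P a).filter (fun q => q.2.1 = q.1.2)) := by
      intro q hq
      simp only [hG, mem_union, mem_filter, hq, true_and]
      tauto
    have h2 : ((P a ×ˢ P a).filter (fun q => q.2.1 = q.1.1)).card ≤ (P a).card := by
      refine card_le_card_of_injOn Prod.fst (fun q hq => ?_) ?_
      · exact (mem_product.1 (mem_filter.1 hq).1).1
      · rintro ⟨⟨b, c⟩, ⟨b', c'⟩⟩ h ⟨⟨b₁, c₁⟩, ⟨b₁', c₁'⟩⟩ h' he
        simp only [hP, mem_coe, mem_filter, mem_product, mem_univ, true_and] at h h'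
        simp only [Prod.mk.injEq] at he
        obtain ⟨rfl, rfl⟩ := he
        obtain ⟨⟨-, h2⟩, rfl⟩ := h
        obtain ⟨⟨-, h2'⟩, rfl⟩ := h'
        rw [hT.unique h2 h2']
    have h3 : ((P a ×ˢ P a).filter (fun q => q.2.1 = q.1.2)).card ≤ (P a).card := by
      refine card_le_card_of_injOn Prod.fst (fun q hq => ?_) ?_
      · exact (mem_product.1 (mem_filter.1 hq).1).1
      · rintro ⟨⟨b, c⟩, ⟨b', c'⟩⟩ h ⟨⟨b₁, c₁⟩, ⟨b₁', c₁'⟩⟩ h' he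
        simp only [hP, mem_coe, mem_filter, mem_product, mem_univ, true_and] at h h'
        simp only [Prod.mk.injEq] at he
        obtain ⟨rfl, rfl⟩ := he
        obtain ⟨⟨-, h2⟩, rfl⟩ := h
        obtain ⟨⟨-, h2'⟩, rfl⟩ := h'
        rw [hT.unique h2 h2']
    have h4 := (card_le_card h1).trans (card_union_le _ _)
    have h5 := card_union_le ((P a ×ˢ P a).filter (fun q => q.2.1 = q.1.1))
      ((P a ×ˢ P a).filter (fun q => q.2.1 = q.1.2))
    rw [card_product, ← sq] at h4
    omega
  have hsum : ∑ a, (P a).card ^ 2 ≤ {p : (S × S) × (S × S) | PairAdj T p.1 p.2}.ncard +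
      2 * ∑ a, (P a).card := by
    refine (sum_le_sum fun a _ => hGcard a).trans ?_
    rw [sum_add_distrib, ← mul_sum]
    exact Nat.add_le_add_right hGle _
  have hcs := sq_sum_le_card_mul_sum_sq (s := (univ : Finset S)) (f := fun a => (P a).card)
  rw [hτ]
  exact_mod_cast hcs.trans (Nat.mul_le_mul_left _ hsum)

/-- A dense linear triple relation contains a cyclic arrangement of pairwise distinct vertices
describing a 2-regular subhypergraph with `4 * (m + 1)` edges. -/
theorem exists_injective_cycle (hT : IsLinearTripleRel T) (m : ℕ)
    (hD : (576 * ((m : ℝ) + 1) ^ 3) ^ (m + 1) * (Fintype.card S : ℝ) ^ 2 <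
      ({p : (S × S) × (S × S) | PairAdj T p.1 p.2}.ncard / (Fintype.card S : ℝ) ^ 2) ^ (m + 1)) :
    ∃ w : Fin (m + 1 + m + 1) × Option Bool → S, Function.Injective w ∧
      ∀ i β, T (w (i, none)) (w (i, some β)) (w (i + 1, some β)) := by
  classical
  -- A bad predecessor is determined by the conflicting step `i` and the two vertex types `β`, `γ`:
  -- hence s = 3 · 3 · (m + 1).
  obtain ⟨x, hx, hR⟩ := exists_closedWalk_not_bad (A := PairAdj T)
    (fun _ _ h => hT.pairAdj_symm h) (m := m) (s := 9 * (m + 1)) (by omega)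
    (fun u z => ∃ (i : Fin (m + 1)) (β γ : Option Bool),
      pairVertex T z (u 0) β = pairVertex T (u i.castSucc) (u i.succ) γ) (by
      intro u _
      have hch : ∀ z : S × S, ∃ q : Fin (m + 1) × Option Bool × Option Bool,
          (∃ (i : Fin (m + 1)) (β γ : Option Bool),
            pairVertex T z (u 0) β = pairVertex T (u i.castSucc) (u i.succ) γ) →
          pairVertex T z (u 0) q.2.1 = pairVertex T (u q.1.castSucc) (u q.1.succ) q.2.2 := by
        intro z
        by_cases h : ∃ (i : Fin (m + 1)) (β γ : Option Bool),
            pairVertex T z (u 0) β = pairVertex T (u i.castSucc) (u i.succ) γ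
        · obtain ⟨i, β, γ, h⟩ := h
          exact ⟨(i, β, γ), fun _ => h⟩
        · exact ⟨(0, none, none), fun h' => absurd h' h⟩
      choose f hf using hch
      refine (Set.ncard_le_ncard_of_injOn (t := Set.univ) f (fun _ _ => Set.mem_univ _)
        ?_ Set.finite_univ).trans_eq ?_
      · rintro z ⟨hz, hzR⟩ z' ⟨hz', hzR'⟩ he
        have h1 := hf z hzR
        rw [he, ← hf z' hzR'] at h1
        exact hT.eq_of_pairVertex_eq hz hz' _ h1
      · rw [Set.ncard_univ, Nat.card_eq_fintype_card]
        simp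
        ring) (by
      have h1 : (64 * ((m : ℝ) + 1) ^ 2 * ((9 * (m + 1) : ℕ) : ℝ)) = 576 * ((m : ℝ) + 1) ^ 3 := by
        push_cast
        ring
      rw [h1, Fintype.card_prod, Nat.cast_mul, ← sq]
      exact hD)
  have hnear : ∀ (p : Fin (m + 1 + m + 1)) (i : Fin (m + 1)) (β γ : Option Bool),
      pairVertex T (x p) (x (p + 1)) β ≠
        pairVertex T (x (p + Fin.castLE (by omega) i.succ)) (x (p + Fin.castLE (by omega) i.succ + 1)) γ := by
    intro p i β γ he
    refine hR (p + 1) ⟨i, β, γ, ?_⟩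
    have e1 : Fin.last (m + 1 + m) + (p + 1) = p := by
      rw [add_left_comm, Fin.last_add_one, add_zero]
    have e2 : (Fin.castLE (by omega) (0 : Fin (m + 1 + 1)) : Fin (m + 1 + m + 1)) + (p + 1) =
        p + 1 := by
      rw [show (Fin.castLE (by omega) (0 : Fin (m + 1 + 1)) : Fin (m + 1 + m + 1)) = 0 from rfl,
        zero_add]
    have e3 : (Fin.castLE (by omega) i.castSucc : Fin (m + 1 + m + 1)) + (p + 1) =
        p + Fin.castLE (by omega) i.succ := by
      have : (Fin.castLE (by omega) i.succ : Fin (m + 1 + m + 1)) =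
          Fin.castLE (by omega) i.castSucc + 1 := by
        refine Fin.ext ?_
        rw [Fin.val_add_one_of_lt (Fin.lt_def.2 (by simp; omega))]
        simp
      rw [this, add_left_comm]
    have e4 : (Fin.castLE (by omega) i.succ : Fin (m + 1 + m + 1)) + (p + 1) =
        p + Fin.castLE (by omega) i.succ + 1 := by
      exact (add_left_comm _ _ _).trans (add_assoc _ _ _).symm
    simp only [e1, e2, e3, e4]
    exact he
  -- On a cycle of length 2(m + 1), one of two distinct positions follows the other within m + 1
  -- steps, so every conflict is seen by some window.
  have hcases : ∀ p q : Fin (m + 1 + m + 1), p ≠ q →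
      (∃ i : Fin (m + 1), q = p + Fin.castLE (by omega) i.succ) ∨
        ∃ i : Fin (m + 1), p = q + Fin.castLE (by omega) i.succ := by
    have h0 : ∀ p q : Fin (m + 1 + m + 1), p ≠ q → (q - p).val ≤ m + 1 →
        ∃ i : Fin (m + 1), q = p + Fin.castLE (by omega) i.succ := by
      intro p q hpq h
      have h1 : (q - p).val ≠ 0 := by
        intro h1
        exact hpq (sub_eq_zero.1 (Fin.ext h1 : q - p = 0)).symm
      refine ⟨⟨(q - p).val - 1, by omega⟩, ?_⟩
      rw [← sub_eq_iff_eq_add']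
      refine Fin.ext ?_
      simp only [Fin.val_castLE, Fin.val_succ]
      omega
    intro p q hpq
    by_cases h : (q - p).val ≤ m + 1
    · exact Or.inl (h0 p q hpq h)
    · refine Or.inr (h0 q p hpq.symm ?_)
      rw [← neg_sub q p, Fin.val_neg']
      refine (Nat.mod_le _ _).trans ?_
      omega
  refine ⟨fun q => pairVertex T (x q.1) (x (q.1 + 1)) q.2, ?_,
    fun i β => pairVertex_spec (hx i) β _⟩
  rintro ⟨p, β⟩ ⟨q, γ⟩ he
  by_cases hpq : p = q
  · subst hpq
    exact congrArg _ (hT.pairVertex_injective (hx p) he)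
  · exfalso
    rcases hcases p q hpq with ⟨i, rfl⟩ | ⟨i, rfl⟩
    · exact hnear p i β γ he
    · exact hnear q i γ β he.symm

end IsLinearTripleRel

/-! ### The 2-regular hypergraph of a cyclic configuration. -/

namespace Hypergraph

open Set

/-- The 3-graph whose edges are `{w (i, none), w (i, some β), w (i + 1, some β)}`. -/
def ofCycle {α : Type*} {N : ℕ} (w : Fin (N + 1) × Option Bool → α) : Hypergraph α where
  vertexSet := range w
  edgeSet := range fun q : Fin (N + 1) × Bool =>
    {w (q.1, none), w (q.1, some q.2), w (q.1 + 1, some q.2)}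
  subset_vertexSet_of_mem_edgeSet' := by
    rintro _ ⟨q, rfl⟩ v (rfl | rfl | rfl) <;> exact mem_range_self _

section ofCycle

variable {α : Type*} {N : ℕ} {w : Fin (N + 1) × Option Bool → α}

theorem mem_ofCycle_edge (hw : Function.Injective w) (q : Fin (N + 1) × Bool)
    (r : Fin (N + 1) × Option Bool) :
    w r ∈ ({w (q.1, none), w (q.1, some q.2), w (q.1 + 1, some q.2)} : Set α) ↔
      r = (q.1, none) ∨ r = (q.1, some q.2) ∨ r = (q.1 + 1, some q.2) := by
  simp only [mem_insert_iff, mem_singleton_iff, hw.eq_iff]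

theorem ofCycle_edge_injective (hw : Function.Injective w) :
    Function.Injective fun q : Fin (N + 1) × Bool =>
      ({w (q.1, none), w (q.1, some q.2), w (q.1 + 1, some q.2)} : Set α) := by
  rintro ⟨i, β⟩ ⟨j, γ⟩ h
  dsimp only at h
  have h1 := (mem_ofCycle_edge hw (j, γ) (i, none)).1 (h ▸ by simp)
  have h2 := (mem_ofCycle_edge hw (j, γ) (i, some β)).1 (h ▸ by simp)
  simp only [Prod.mk.injEq, reduceCtorEq, and_false, or_false, and_true, false_or,
    Option.some.injEq] at h1 h2
  subst h1
  rcases h2 with h2 | h2 <;> rw [h2.2]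

theorem encard_ofCycle_edgeSet (hw : Function.Injective w) :
    (ofCycle w).edgeSet.encard = ((2 * (N + 1) : ℕ) : ℕ∞) := by
  change (range _).encard = _
  rw [← image_univ, (ofCycle_edge_injective hw).encard_image, encard_univ]
  simp [mul_comm]

/-- The vertex (i, none) lies in the edges (i, false) and (i, true); the vertex (i, some β) lies in
(i, β) and (i - 1, β). -/
theorem ofCycle_isRegular (hw : Function.Injective w) (hN : 1 < N) :
    (ofCycle w).IsRegular 2 := by
  refine ⟨range_nonempty _, ?_⟩
  rintro _ ⟨r, rfl⟩
  have hdeg : (ofCycle w).degree (w r) =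
      {q : Fin (N + 1) × Bool |
        r = (q.1, none) ∨ r = (q.1, some q.2) ∨ r = (q.1 + 1, some q.2)}.encard := by
    rw [degree, ← (ofCycle_edge_injective hw).encard_image]
    congr 1
    ext e
    constructor
    · rintro ⟨⟨q, rfl⟩, hq⟩
      exact ⟨q, (mem_ofCycle_edge hw q r).1 hq, rfl⟩
    · rintro ⟨q, hq, rfl⟩
      exact ⟨⟨q, rfl⟩, (mem_ofCycle_edge hw q r).2 hq⟩
  rw [hdeg]
  obtain ⟨i, _ | β⟩ := r
  · have : {q : Fin (N + 1) × Bool | (i, (none : Option Bool)) = (q.1, none) ∨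
        (i, none) = (q.1, some q.2) ∨ (i, none) = (q.1 + 1, some q.2)} =
        {(i, false), (i, true)} := by
      ext ⟨j, γ⟩
      cases γ <;> simp [eq_comm]
    rw [this, encard_pair (by simp)]
    rfl
  · have : {q : Fin (N + 1) × Bool | (i, some β) = (q.1, none) ∨
        (i, some β) = (q.1, some q.2) ∨ (i, some β) = (q.1 + 1, some q.2)} =
        {(i, β), (i - 1, β)} := by
      ext ⟨j, γ⟩
      have : i = j + 1 ↔ j = i - 1 := by rw [eq_sub_iff_add_eq, eq_comm]
      simp only [mem_ofPred_eq, mem_insert_iff, mem_singleton_iff, Prod.mk.injEq, reduceCtorEq,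
        and_false, false_or, Option.some.injEq, this, eq_comm (a := i) (b := j),
        eq_comm (a := β) (b := γ)]
    rw [this, encard_pair]
    · rfl
    · simp only [ne_eq, Prod.mk.injEq, and_true]
      intro h
      have h1 : (1 : Fin (N + 1)) = 0 := sub_eq_self.1 h.symm
      have h2 := congrArg Fin.val h1
      rw [Fin.val_one', Fin.val_zero, Nat.mod_eq_of_lt (by omega)] at h2
      exact one_ne_zero h2

end ofCycle

/-! ### From dense linear 3-graphs to extremal numbers. -/

/-- The ordered edges of a 3-graph. -/
def OrderedEdge {α : Type*} (H : Hypergraph α) (a b c : H.vertexSet) : Prop :=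
  ({(a : α), (b : α), (c : α)} : Set α) ∈ H.edgeSet ∧ a ≠ b ∧ a ≠ c ∧ b ≠ c

theorem IsLinear.isLinearTripleRel {α : Type*} {H : Hypergraph α} (hH : H.IsLinear) :
    IsLinearTripleRel H.OrderedEdge where
  swap_left := by
    rintro a b c ⟨h, h1, h2, h3⟩
    exact ⟨by rwa [insert_comm], h1.symm, h3, h2⟩
  swap_right := by
    rintro a b c ⟨h, h1, h2, h3⟩
    exact ⟨by rwa [pair_comm (c : α)], h2, h1, h3.symm⟩
  ne h := h.2.1
  unique := by
    rintro a b c c' ⟨h, h1, h2, h3⟩ ⟨h', -, h2', h3'⟩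
    by_contra hc
    have hne : ({(a : α), (b : α), (c : α)} : Set α) ≠ {(a : α), (b : α), (c' : α)} := by
      intro he
      have : (c : α) ∈ ({(a : α), (b : α), (c' : α)} : Set α) := he ▸ by simp
      simp only [mem_insert_iff, mem_singleton_iff, Subtype.coe_inj] at this
      tauto
    have h4 := hH _ h _ h' hne
    have h5 : ({(a : α), (b : α)} : Set α) ⊆
        {(a : α), (b : α), (c : α)} ∩ {(a : α), (b : α), (c' : α)} := by
      intro v hv
      simp only [mem_insert_iff, mem_singleton_iff, mem_inter_iff] at hv ⊢
      tauto
    have h6 := (encard_le_encard h5).trans h4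
    rw [encard_pair (by simpa [Subtype.coe_inj] using h1)] at h6
    exact absurd h6 (by decide)

theorem IsUniform.ncard_edgeSet_le {α : Type*} {H : Hypergraph α} [Finite H.vertexSet]
    (hH : H.IsUniform 3) :
    H.edgeSet.ncard ≤ {q : H.vertexSet × H.vertexSet × H.vertexSet |
      H.OrderedEdge q.1 q.2.1 q.2.2}.ncard := by
  refine (ncard_le_ncard (t := (fun q : H.vertexSet × H.vertexSet × H.vertexSet =>
    ({(q.1 : α), (q.2.1 : α), (q.2.2 : α)} : Set α)) '' _) ?_ (toFinite _)).trans
    (ncard_image_le (toFinite _))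
  intro e he
  obtain ⟨a, b, c, h1, h2, h3, rfl⟩ := encard_eq_three.1 (hH e he)
  have hs := H.subset_vertexSet_of_mem_edgeSet' he
  refine ⟨(⟨a, hs (by simp)⟩, ⟨b, hs (by simp)⟩, ⟨c, hs (by simp)⟩), ⟨he, ?_, ?_, ?_⟩, rfl⟩
  all_goals simpa

/-- A linear 3-graph with at least `576 * ℓ ^ 3 * n ^ (3 / 2 + 1 / ℓ)` edges contains a 2-regular
subhypergraph with exactly `4 * ℓ` edges. -/
theorem IsLinearThreeGraph.exists_isRegular_two {α : Type*} {H : Hypergraph α} {n : ℕ}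
    (hH : H.IsLinearThreeGraph n) {ℓ : ℕ} (hℓ : 2 ≤ ℓ)
    (he : 576 * (ℓ : ℝ) ^ 3 * (n : ℝ) ^ ((3 : ℝ) / 2 + 1 / (ℓ : ℝ)) < H.edgeSet.ncard) :
    ∃ F : Hypergraph α, F.IsSubhypergraph H ∧ F.IsRegular 2 ∧
      F.edgeSet.encard = ((4 * ℓ : ℕ) : ℕ∞) := by
  obtain ⟨m, rfl⟩ : ∃ m, ℓ = m + 1 := ⟨ℓ - 1, by omega⟩
  have hfin : H.vertexSet.Finite := finite_of_encard_eq_coe hH.encard_vertexSet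
  have := hfin.to_subtype
  have := Fintype.ofFinite H.vertexSet
  have hcard : Fintype.card H.vertexSet = n := by
    rw [← Nat.card_eq_fintype_card, Nat.card_coe_set_eq, ncard, hH.encard_vertexSet]
    rfl
  have hT := hH.linear.isLinearTripleRel
  have hcount := hT.le_ncard_pairAdj
  rw [hcard] at hcount
  set τ : ℝ := ({q : H.vertexSet × H.vertexSet × H.vertexSet |
      H.OrderedEdge q.1 q.2.1 q.2.2}.ncard : ℝ) with hτ
  set D : ℝ := ({p : (H.vertexSet × H.vertexSet) × (H.vertexSet × H.vertexSet) |
      PairAdj H.OrderedEdge p.1 p.2}.ncard : ℝ) with hD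
  set k : ℝ := (m : ℝ) + 1 with hk
  have hk1 : 2 ≤ k := by
    have : ((2 : ℕ) : ℝ) ≤ ((m + 1 : ℕ) : ℝ) := by exact_mod_cast hℓ
    push_cast at this
    exact this
  push_cast at he
  rw [← hk] at he
  set y : ℝ := (n : ℝ) ^ ((3 : ℝ) / 2 + 1 / k) with hy
  have hτy : 576 * k ^ 3 * y < τ := he.trans_le (Nat.cast_le.2 hH.uniform.ncard_edgeSet_le)
  have hy0 : 0 ≤ y := Real.rpow_nonneg (Nat.cast_nonneg _) _
  have hτ0 : 0 < τ := lt_of_le_of_lt (by positivity) hτy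
  have hn1 : 1 ≤ n := by
    rcases Nat.eq_zero_or_pos n with h0 | h0
    · exfalso
      rw [h0] at hcount
      simp only [Nat.cast_zero, zero_mul] at hcount
      nlinarith
    · exact h0
  have hn1' : (1 : ℝ) ≤ n := by exact_mod_cast hn1
  have hny : (n : ℝ) ≤ y := by
    calc (n : ℝ) = (n : ℝ) ^ (1 : ℝ) := (Real.rpow_one _).symm
      _ ≤ y := by
        refine Real.rpow_le_rpow_of_exponent_le hn1' ?_
        have : 0 ≤ 1 / k := by positivity
        linarith
  -- The exponent 3/2 + 1/k is the one for which y²/n³ = n^(2/k), whose k-th power is n², the number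
  -- of pairs.
  have hypow : (y ^ 2) ^ (m + 1) = ((n : ℝ) ^ 3) ^ (m + 1) * (n : ℝ) ^ 2 := by
    have h1 : ((n : ℝ) ^ 3) ^ (m + 1) * (n : ℝ) ^ 2 = (n : ℝ) ^ (3 * (m + 1) + 2) := by ring
    rw [h1, ← pow_mul, hy, ← Real.rpow_mul_natCast (by linarith), ← Real.rpow_natCast]
    congr 1
    push_cast
    rw [← hk]
    field_simp
  have hk8 : 8 ≤ k ^ 3 := by
    calc (8 : ℝ) = 2 ^ 3 := by norm_num
      _ ≤ k ^ 3 := by gcongr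
  have hτn : 4 * (n : ℝ) ≤ τ := by nlinarith
  have hτ2 : 2 * (576 * k ^ 3) * y ^ 2 < τ ^ 2 := by
    have h1 : (576 * k ^ 3 * y) ^ 2 < τ ^ 2 := by gcongr
    have h2 : 2 * (576 * k ^ 3) * y ^ 2 ≤ (576 * k ^ 3 * y) ^ 2 := by
      have : 2 * (576 * k ^ 3) ≤ (576 * k ^ 3) ^ 2 := by nlinarith
      calc _ ≤ (576 * k ^ 3) ^ 2 * y ^ 2 := by gcongr
        _ = _ := by ring
    linarith
  -- Since 4n ≤ τ, the degenerate term 2nτ is at most τ²/2 and is absorbed.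
  have hD1 : τ ^ 2 ≤ 2 * n * D := by nlinarith
  have hD2 : 576 * k ^ 3 * y ^ 2 < n * D := by linarith
  obtain ⟨w, hw, hwT⟩ := hT.exists_injective_cycle m (by
    rw [hcard, ← hk, ← hD]
    have hn3 : (0 : ℝ) < (n : ℝ) ^ 3 := by positivity
    have h1 : D / (n : ℝ) ^ 2 = n * D / (n : ℝ) ^ 3 := by field_simp
    have h2 : 576 * k ^ 3 * y ^ 2 / (n : ℝ) ^ 3 < D / (n : ℝ) ^ 2 := by
      rw [h1]
      gcongr
    calc _ = (576 * k ^ 3 * y ^ 2 / (n : ℝ) ^ 3) ^ (m + 1) := by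
          rw [div_pow, mul_pow _ (y ^ 2), hypow]
          field_simp
      _ < _ := pow_lt_pow_left₀ h2 (by positivity) (by omega))
  have hw' : Function.Injective fun q => (w q : α) := Subtype.val_injective.comp hw
  refine ⟨ofCycle fun q => (w q : α), ⟨?_, ?_⟩, ofCycle_isRegular hw' (by omega), ?_⟩
  · rintro _ ⟨q, rfl⟩
    exact (w q).2
  · rintro _ ⟨q, rfl⟩
    exact (hwT q.1 q.2).1
  · rw [encard_ofCycle_edgeSet hw']
    congr 1
    omega

theorem exTwoRegular_le_cube (n t : ℕ) : exTwoRegular n t ≤ n ^ 3 := by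
  obtain ⟨H, hH, hm, -⟩ := (isGreatest_exTwoRegular n t).1
  have h1 : H.edgeSet.ncard = exTwoRegular n t := by simp [ncard, hm]
  have h2 := hH.uniform.ncard_edgeSet_le
  rw [h1] at h2
  refine h2.trans ((ncard_le_card _).trans ?_)
  have h3 : Nat.card H.vertexSet = n := by
    rw [Nat.card_coe_set_eq, ncard, hH.encard_vertexSet]
    rfl
  rw [Nat.card_prod, Nat.card_prod, h3]
  exact le_of_eq (by ring)

theorem exTwoRegular_le (n : ℕ) {ℓ t : ℕ} (hℓ : 2 ≤ ℓ) (ht : 4 * ℓ ≤ t) :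
    (exTwoRegular n t : ℝ) ≤ 576 * (ℓ : ℝ) ^ 3 * (n : ℝ) ^ ((3 : ℝ) / 2 + 1 / (ℓ : ℝ)) := by
  obtain ⟨H, hH, hm, hF⟩ := (isGreatest_exTwoRegular n t).1
  have h1 : H.edgeSet.ncard = exTwoRegular n t := by simp [ncard, hm]
  by_contra! hlt
  rw [← h1] at hlt
  obtain ⟨F, hFH, hreg, hcard⟩ := hH.exists_isRegular_two hℓ hlt
  refine hF ⟨F, hFH, hreg, ?_⟩
  rw [hcard]
  exact_mod_cast ht

end Hypergraph

theorem theorem1p2 :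
    (∀ ℓ : ℕ, 2 ≤ ℓ → ∃ c : ℝ, ∀ n : ℕ,
      (∀ (α : Type*) (H : Hypergraph α), H.IsLinearThreeGraph n →
        c * (n : ℝ) ^ ((3 : ℝ) / 2 + 1 / (ℓ : ℝ)) < (H.edgeSet.ncard : ℝ) →
        ∃ F : Hypergraph α, F.IsSubhypergraph H ∧ F.IsRegular 2 ∧
          F.edgeSet.encard = ((4 * ℓ : ℕ) : ℕ∞)) ∧
      (Hypergraph.exTwoRegular n (4 * ℓ) : ℝ) ≤ c * (n : ℝ) ^ ((3 : ℝ) / 2 + 1 / (ℓ : ℝ))) ∧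
    (∃ C : ℝ, ∀ t : ℕ, 1 ≤ t → ∃ c : ℝ, ∀ n : ℕ,
      (Hypergraph.exTwoRegular n t : ℝ) ≤ c * (n : ℝ) ^ ((3 : ℝ) / 2 + C / (t : ℝ))) := by
  refine ⟨fun ℓ hℓ => ⟨576 * (ℓ : ℝ) ^ 3, fun n => ⟨fun α H hH he =>
    hH.exists_isRegular_two hℓ he, Hypergraph.exTwoRegular_le n hℓ le_rfl⟩⟩, 16, fun t ht => ?_⟩
  have ht0 : (0 : ℝ) < t := by exact_mod_cast ht
  have hmono : ∀ (n : ℕ) {a b : ℝ}, 0 < a → a ≤ b → (n : ℝ) ^ a ≤ (n : ℝ) ^ b := by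
    intro n a b ha hab
    rcases Nat.eq_zero_or_pos n with rfl | hn
    · rw [Nat.cast_zero, Real.zero_rpow ha.ne', Real.zero_rpow (ha.trans_le hab).ne']
    · exact Real.rpow_le_rpow_of_exponent_le (by exact_mod_cast hn) hab
  -- For t ≥ 8 take ℓ = ⌊t/4⌋ ≥ 2, with 1/ℓ ≤ 16/t. For t < 8 the exponent 3/2 + 16/t exceeds 3, so
  -- the trivial cubic bound suffices.
  rcases le_or_gt 8 t with h8 | h8
  · have hℓ : 2 ≤ t / 4 := by omega
    have hℓ0 : (0 : ℝ) < (t / 4 : ℕ) := by exact_mod_cast (by omega : 0 < t / 4)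
    refine ⟨576 * ((t / 4 : ℕ) : ℝ) ^ 3, fun n =>
      (Hypergraph.exTwoRegular_le n hℓ (Nat.mul_div_le t 4)).trans ?_⟩
    refine mul_le_mul_of_nonneg_left (hmono n (by positivity) ?_) (by positivity)
    have h16 : (t : ℝ) ≤ 16 * (t / 4 : ℕ) := by exact_mod_cast (by omega : t ≤ 16 * (t / 4))
    have : 1 / ((t / 4 : ℕ) : ℝ) ≤ 16 / (t : ℝ) := by
      rw [div_le_div_iff₀ hℓ0 ht0]
      linarith
    linarith
  · refine ⟨1, fun n => ?_⟩
    have h1 : (Hypergraph.exTwoRegular n t : ℝ) ≤ (n : ℝ) ^ (3 : ℝ) := by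
      rw [show (3 : ℝ) = ((3 : ℕ) : ℝ) by norm_num, Real.rpow_natCast]
      exact_mod_cast Hypergraph.exTwoRegular_le_cube n t
    rw [one_mul]
    refine h1.trans (hmono n (by norm_num) ?_)
    have h8' : (t : ℝ) ≤ 8 := by exact_mod_cast h8.le
    have : 2 ≤ 16 / (t : ℝ) := by
      rw [le_div_iff₀ ht0]
      linarith
    linarith
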